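/- Let $N\ge 2$ be an integer, $m>0$, $\beta>1$, $$2\le p<\frac{2(N\beta-1)}{\beta(N-1)},\qquad r>\max\Big\{1,\frac{1-N\beta}{2+\beta N(p-2)-\beta p}\Big\}.$$ Let $V\colon\mathbb R^N\to\mathbb R$ be continuous with $\inf V>-B$ for some $B>0$; let $A\in L^\infty_{\mathrm{loc}}(\mathbb R^N)$ with $A\ge 1$ a.e., and suppose that there are $C_0,R_0>0$ with $A(x)^{\frac{2r}{2r-1}}\le C_0\big(1+\max\{0,V(x)\}^{1/\beta}\big)$ for a.e. $|x|>R_0$; let $W=W_1+W_2$ a.e. with $W_1\in L^r(\mathbb R^N)$ and $W_2\in L^\infty(\mathbb R^N)$ real-valued. Define $$\|u\|_X^2=\int_{\mathbb R^N}\big|(-\Delta+m^2)^{1/4}u\big|^2\,dx+\int_{\mathbb R^N}V|u|^2\,dx,$$ let $X$ be the space of (real- or complex-valued) $u\in L^2(\mathbb R^N)$ for which $(-\Delta+m^2)^{1/4}u\in L^2(\mathbb R^N)$ and $\int V|u|^2<\infty$, and assume that $\lambda_1=\inf_{u\in X\setminus\{0\}}\|u\|_X^2/\|u\|_{L^2}^2>0$.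 For $u \in X$ put $$Q(u)=\int_{\mathbb R^N\times\mathbb R^N}W(x-y)A(x)|u(x)|^p|u(y)|^p\,dx\,dy,\qquad I(u)=\tfrac12\|u\|_X^2-\tfrac1{2p}Q(u).$$ Then the double integral $Q(u)$ converges absolutely for every $u\in X$, and $I$ has the mountain pass geometry: $I(0)=0$ and there is $\rho>0$ such that 1. there is $\alpha>0$ with $I(u)\ge\alpha$ (in particular $I(u)>0$) for all $u\in X$ with $\|u\|_X=\rho$; 2. provided that $Q(u)>0$ for some $u\in X$, there is $e\in X$ with $\|e\|_X>\rho$ and $I(e)<0$. The proviso in 2 is satisfied whenever $W\ge 0$ a.e. and $W$ is not a.e. equal to $0$. -/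

import Mathlib

open MeasureTheory FourierTransform

noncomputable section

namespace Hartree

/-- The Hilbert space `L²(ℝᴺ; 𝕜)` of real (`𝕜 = ℝ`) or complex (`𝕜 = ℂ`) valued functions. -/
abbrev L2 (N : ℕ) (𝕜 : Type*) [RCLike 𝕜] : Type _ :=
  Lp 𝕜 2 (volume : Measure (EuclideanSpace ℝ (Fin N)))

variable {N : ℕ} {𝕜 : Type*} [RCLike 𝕜]

/-- A function in `L²(ℝᴺ; 𝕜)`, regarded as a complex-valued one. -/
def toComplex (u : L2 N 𝕜) : L2 N ℂ :=
  (RCLike.map 𝕜 ℂ).compLp u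

/-- The Fourier symbol `(|2πξ|² + m²)^{1/4}` of `(-Δ + m²)^{1/4}`; Mathlib's Fourier transform is
`𝓕 u (ξ) = ∫ exp (-2πi x·ξ) u(x) dx`, so that `-Δ` has the symbol `|2πξ|²`. -/
def symbol (m : ℝ) (ξ : EuclideanSpace ℝ (Fin N)) : ℝ :=
  ((2 * Real.pi * ‖ξ‖) ^ 2 + m ^ 2) ^ (1 / 4 : ℝ)

/-- `(-Δ + m²)^{1/4} u` on the Fourier side. -/
def symbolMul (m : ℝ) (u : L2 N 𝕜) : EuclideanSpace ℝ (Fin N) → ℂ :=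
  fun ξ => (symbol m ξ : ℂ) * (𝓕 (toComplex u) : L2 N ℂ) ξ

/-- `u ∈ L^{1/2,2}(ℝᴺ)`, that is, `u ∈ L²` and `(-Δ + m²)^{1/4} u ∈ L²`. -/
def MemBessel (m : ℝ) (u : L2 N 𝕜) : Prop :=
  MemLp (symbolMul m u) 2 volume

open Classical in
/-- The function `(-Δ + m²)^{1/4} u ∈ L²`, for `u ∈ L^{1/2,2}` (and `0` otherwise). -/
def besselRoot (m : ℝ) (u : L2 N 𝕜) : L2 N ℂ :=
  if h : MemBessel m u then 𝓕⁻ (h.toLp (symbolMul m u) : L2 N ℂ) else 0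

/-- The weighted space `X`. For `V` bounded from below and `u ∈ L²`, finiteness of `∫ V |u|²`
is integrability of `V |u|²`. -/
def X (𝕜 : Type*) [RCLike 𝕜] (m : ℝ) (V : EuclideanSpace ℝ (Fin N) → ℝ) : Set (L2 N 𝕜) :=
  {u | MemBessel m u ∧ Integrable (fun x => V x * ‖u x‖ ^ 2) volume}

/-- `∫ |(-Δ + m²)^{1/4} u|² + ∫ V |u|²`, the square of the norm of `X`. -/
def normXSq (m : ℝ) (V : EuclideanSpace ℝ (Fin N) → ℝ) (u : L2 N 𝕜) : ℝ :=
  (∫ x, ‖besselRoot m u x‖ ^ 2) + ∫ x, V x * ‖u x‖ ^ 2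

/-- The norm of `X`. -/
def normX (m : ℝ) (V : EuclideanSpace ℝ (Fin N) → ℝ) (u : L2 N 𝕜) : ℝ :=
  Real.sqrt (normXSq m V u)

/-- `λ₁`, the infimum over `X \ {0}` of the quotient of `normXSq` and the square of the
`L²` norm. -/
def lambda1 (𝕜 : Type*) [RCLike 𝕜] (m : ℝ) (V : EuclideanSpace ℝ (Fin N) → ℝ) : ℝ :=
  sInf {q : ℝ | ∃ u ∈ X 𝕜 m V, u ≠ 0 ∧ q = normXSq m V u / ‖u‖ ^ 2}

/-- The integrand `W(x - y) A(x) |u(x)|^p |u(y)|^p` of the nonlocal term. -/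
def nonlocalIntegrand (p : ℝ) (A W : EuclideanSpace ℝ (Fin N) → ℝ) (u : L2 N 𝕜) :
    EuclideanSpace ℝ (Fin N) × EuclideanSpace ℝ (Fin N) → ℝ :=
  fun z => W (z.1 - z.2) * A z.1 * ‖u z.1‖ ^ p * ‖u z.2‖ ^ p

/-- The nonlocal term `∬ W(x - y) A(x) |u(x)|^p |u(y)|^p dx dy`. -/
def nonlocalTerm (p : ℝ) (A W : EuclideanSpace ℝ (Fin N) → ℝ) (u : L2 N 𝕜) : ℝ :=
  ∫ z, nonlocalIntegrand p A W u z

/-- The functional `I`. -/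
def I (m p : ℝ) (V A W : EuclideanSpace ℝ (Fin N) → ℝ) (u : L2 N 𝕜) : ℝ :=
  1 / 2 * normX m V u ^ 2 - 1 / (2 * p) * nonlocalTerm p A W u

end Hartree

end

/-! Everything follows from one estimate, `exists_nonlocalTerm_le`: on the part of `X` where
`normXSq` is at most 1, the integrand is integrable and the nonlocal term is bounded above. The
nonlocal term is homogeneous of degree `2 * p`, which is at least 4, and `normXSq` of degree 2; so
the quadratic part wins on a small sphere and the nonlocal part wins far out on a ray where it is
positive.

For the estimate put `s = 2r / (2r - 1)` and `a = A |u|^p`. Since `A ≥ 1`, the factor `|u(y)|^p` may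
be replaced by `a(y)`, and a pointwise Young inequality (`mul_mul_le_young`) reduces the `W₁` part
to the integrability of `a ^ s`. The growth condition on `A` and weighted AM-GM
(`one_add_rpow_mul_rpow_le`) bound `a ^ s` by a multiple of `|u|^2 + |u|^q + V⁺ |u|^2`, where `q =
(p s β - 2) / (β - 1)`. The hypotheses on `p` and `r` say that `q` is below the critical exponent
`2N / (N - 1)`, so `exists_integral_control_le` applies. It rests on a subcritical Sobolev bound,
obtained from a frequency cut-off depending on the level `t` and a layer-cake integral. -/

noncomputable section

namespace Hartree

/-! ### Fourier analysis and the Sobolev embedding -/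

/-- The inverse Fourier transform of a function in `L¹ ∩ L²` is bounded by its `L¹` norm. -/
theorem ae_norm_fourierInv_le {N : ℕ} (f : L2 N ℂ) (hf : Integrable f volume) :
    ∀ᵐ x, ‖(𝓕⁻ f : L2 N ℂ) x‖ ≤ ∫ ξ, ‖f ξ‖ := by
  set g : EuclideanSpace ℝ (Fin N) → ℂ := 𝓕⁻ (f : EuclideanSpace ℝ (Fin N) → ℂ) with hg
  have hgb : ∀ x, ‖g x‖ ≤ ∫ ξ, ‖f ξ‖ := fun x =>
    VectorFourier.norm_fourierIntegral_le_integral_norm _ _ _ _ _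
  have hgc : Continuous g := by
    refine VectorFourier.fourierIntegral_continuous Real.continuous_fourierChar ?_ hf
    simp only [LinearMap.neg_apply]
    exact (continuous_inner (𝕜 := ℝ)).neg
  -- The `L²` transform and the integral transform agree because they agree against test functions:
  -- the former by duality of tempered distributions, the latter by the multiplication formula.
  have key : (𝓕⁻ f : L2 N ℂ) =ᵐ[volume] g := by
    refine ae_eq_of_integral_contDiff_smul_eq ?_ hgc.locallyIntegrable ?_
    · exact (Lp.memLp (𝓕⁻ f : L2 N ℂ)).locallyIntegrable (by norm_num)
    · intro φ hφ hφc
      have h1 : HasCompactSupport (fun x => (φ x : ℂ)) :=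
        hφc.comp_left (g := ((↑) : ℝ → ℂ)) (by simp)
      have h2 : ContDiff ℝ ((⊤ : ℕ∞) : WithTop ℕ∞) (fun x => (φ x : ℂ)) :=
        Complex.ofRealCLM.contDiff.comp hφ
      set Φ : SchwartzMap (EuclideanSpace ℝ (Fin N)) ℂ := h1.toSchwartzMap h2 with hΦ
      have hΦx : ∀ x, Φ x = φ x := fun x => rfl
      have e1 := congrArg (fun T => T Φ) (Lp.fourierInv_toTemperedDistribution_eq f)
      simp only [TemperedDistribution.fourierInv_apply, Lp.toTemperedDistribution_apply] at e1
      have e2 := VectorFourier.integral_fourierIntegral_smul_eq_flip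
        (μ := (volume : Measure (EuclideanSpace ℝ (Fin N))))
        (ν := (volume : Measure (EuclideanSpace ℝ (Fin N))))
        (L := -innerₗ (EuclideanSpace ℝ (Fin N))) (e := Real.fourierChar)
        (f := Φ) (g := f) Real.continuous_fourierChar (by
          simp only [LinearMap.neg_apply]
          exact (continuous_inner (𝕜 := ℝ)).neg) Φ.integrable hf
      have hflip : (-innerₗ (EuclideanSpace ℝ (Fin N))).flip =
          -innerₗ (EuclideanSpace ℝ (Fin N)) := by
        ext x y
        simp [real_inner_comm]
      rw [hflip] at e2
      have e3 : ∫ x, Φ x • (𝓕⁻ f : L2 N ℂ) x = ∫ x, Φ x • g x := by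
        rw [← e1, SchwartzMap.fourierInv_coe]
        exact e2
      simpa only [hΦx, Complex.coe_smul, Complex.real_smul, smul_eq_mul] using e3
  filter_upwards [key] with x hx
  rw [hx]; exact hgb x

theorem norm_sq_eq_integral {N : ℕ} {𝕜 : Type*} [RCLike 𝕜] (u : L2 N 𝕜) :
    ‖u‖ ^ 2 = ∫ x, ‖u x‖ ^ 2 := by
  rw [← inner_self_eq_norm_sq (𝕜 := 𝕜), L2.inner_def, ← integral_re (L2.integrable_inner u u)]
  exact integral_congr_ae (Filter.Eventually.of_forall fun x => by
    simp)

theorem integrable_norm_sq {N : ℕ} {𝕜 : Type*} [RCLike 𝕜] (u : L2 N 𝕜) :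
    Integrable (fun x => ‖u x‖ ^ 2) volume :=
  (Lp.memLp u).integrable_norm_pow (by norm_num)

theorem symbol_sq {N : ℕ} (m : ℝ) (ξ : EuclideanSpace ℝ (Fin N)) :
    symbol m ξ ^ 2 = Real.sqrt ((2 * Real.pi * ‖ξ‖) ^ 2 + m ^ 2) := by
  unfold symbol
  rw [← Real.rpow_natCast, ← Real.rpow_mul (by positivity), Real.sqrt_eq_rpow]
  norm_num

/-- This lower bound is all that the Sobolev estimates use of the symbol's size; the mass is
discarded. -/
theorem norm_le_symbol_sq {N : ℕ} (m : ℝ) (ξ : EuclideanSpace ℝ (Fin N)) :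
    ‖ξ‖ ≤ symbol m ξ ^ 2 := by
  rw [symbol_sq]
  apply Real.le_sqrt_of_sq_le
  have h1 : ‖ξ‖ ≤ 2 * Real.pi * ‖ξ‖ :=
    le_mul_of_one_le_left (norm_nonneg _) (by linarith [Real.pi_gt_three])
  have h2 := pow_le_pow_left₀ (norm_nonneg ξ) h1 2
  nlinarith [sq_nonneg m]

theorem continuous_symbol {N : ℕ} (m : ℝ) :
    Continuous (symbol m : EuclideanSpace ℝ (Fin N) → ℝ) := by
  unfold symbol
  exact Continuous.rpow_const (by fun_prop) (fun _ => Or.inr (by norm_num))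

theorem integrableOn_norm_inv_ball {N : ℕ} (hN : 1 < N) (R : ℝ) :
    IntegrableOn (fun ξ : EuclideanSpace ℝ (Fin N) => ‖ξ‖⁻¹) (Metric.ball 0 R) volume := by
  refine integrableOn_ball_of_norm_le_rpow (C := 1) (α := 1) (by simpa using hN.le)
    (by simpa using hN) ?_ (by fun_prop)
  refine Filter.Eventually.of_forall fun x => ?_
  simp [Real.rpow_neg_one]

/-- Polar coordinates. The weight `‖ξ‖⁻¹` is dual to the energy weight on low frequencies, and the
power `N - 1` leads to the critical exponent. -/
theorem exists_integral_norm_inv_ball_le {N : ℕ} (hN : 1 < N) :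
    ∃ c : ℝ, 0 < c ∧ ∀ R : ℝ, 0 < R →
      ∫ ξ in Metric.ball (0 : EuclideanSpace ℝ (Fin N)) R, ‖ξ‖⁻¹ ≤ c * R ^ (N - 1) := by
  obtain ⟨k, rfl⟩ : ∃ k, N = k + 2 := ⟨N - 2, by omega⟩
  refine ⟨(k + 2 : ℕ) * volume.real (Metric.ball (0 : EuclideanSpace ℝ (Fin (k + 2))) 1) /
    (k + 1) + 1, by positivity, fun R hR => ?_⟩
  have h := integral_fun_norm_addHaar (volume : Measure (EuclideanSpace ℝ (Fin (k + 2))))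
    ((Set.Iio R).indicator (fun y : ℝ => y⁻¹))
  have h1 : ∫ ξ in Metric.ball (0 : EuclideanSpace ℝ (Fin (k + 2))) R, ‖ξ‖⁻¹ =
      ∫ ξ : EuclideanSpace ℝ (Fin (k + 2)), (Set.Iio R).indicator (fun y : ℝ => y⁻¹) ‖ξ‖ := by
    rw [← integral_indicator measurableSet_ball]
    congr with ξ
    simp [Set.indicator]
  have h2 : ∫ y in Set.Ioi (0 : ℝ), y ^ (k + 1) • (Set.Iio R).indicator (fun y : ℝ => y⁻¹) y =
      R ^ (k + 1) / (k + 1) := by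
    have : ∫ y in Set.Ioi (0 : ℝ), y ^ (k + 1) • (Set.Iio R).indicator (fun y : ℝ => y⁻¹) y =
        ∫ y in Set.Ioi (0 : ℝ), (Set.Iio R).indicator (fun y : ℝ => y ^ k) y := by
      refine setIntegral_congr_fun measurableSet_Ioi fun y hy => ?_
      have hy : 0 < y := hy
      by_cases hyR : y < R
      · simp [hyR, pow_succ, hy.ne']
      · simp [hyR]
    rw [this, setIntegral_indicator measurableSet_Iio, Set.Ioi_inter_Iio,
      ← integral_Ioc_eq_integral_Ioo, ← intervalIntegral.integral_of_le hR.le, integral_pow]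
    simp
  have : 0 < R ^ (k + 1) := by positivity
  rw [h1, h, finrank_euclideanSpace, Fintype.card_fin, show k + 2 - 1 = k + 1 from rfl, h2,
    smul_eq_mul, nsmul_eq_mul]
  calc _ = (k + 2 : ℕ) * volume.real (Metric.ball (0 : EuclideanSpace ℝ (Fin (k + 2))) 1) /
    (k + 1) * R ^ (k + 1) := by ring
    _ ≤ _ := by nlinarith

/-- Frequency splitting: the part of `u` with frequencies in `S` is bounded, the other part is
controlled by Chebyshev's inequality. -/
theorem measure_lt_norm_le {N : ℕ} (u : L2 N ℂ) {S : Set (EuclideanSpace ℝ (Fin N))}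
    (hS : MeasurableSet S) {t M : ℝ} (ht : 0 < t)
    (hint : IntegrableOn (𝓕 u : L2 N ℂ) S volume)
    (hlow : ∫ ξ in S, ‖(𝓕 u : L2 N ℂ) ξ‖ ≤ t / 2)
    (hhigh : ∫ ξ in Sᶜ, ‖(𝓕 u : L2 N ℂ) ξ‖ ^ 2 ≤ M) :
    volume {x | t < ‖u x‖} ≤ ENNReal.ofReal (4 * M / t ^ 2) := by
  set f : L2 N ℂ := 𝓕 u with hf
  have m1 := (Lp.memLp f).indicator hS
  have m2 := (Lp.memLp f).indicator hS.compl
  set f₁ : L2 N ℂ := m1.toLp _ with hf₁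
  set f₂ : L2 N ℂ := m2.toLp _ with hf₂
  have c1 : f₁ =ᵐ[volume] S.indicator f := m1.coeFn_toLp
  have c2 : f₂ =ᵐ[volume] Sᶜ.indicator f := m2.coeFn_toLp
  have hsum : f = f₁ + f₂ := by
    rw [hf₁, hf₂, ← MemLp.toLp_add]
    conv_lhs => rw [← Lp.toLp_coeFn f (Lp.memLp f)]
    congr 1
    exact (Set.indicator_self_add_compl S f).symm
  have hu : u = 𝓕⁻ f₁ + 𝓕⁻ f₂ := by
    rw [← FourierTransform.fourierInv_add, ← hsum, hf, FourierTransform.fourierInv_fourier_eq]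
  have hb : ∀ᵐ x, ‖(𝓕⁻ f₁ : L2 N ℂ) x‖ ≤ t / 2 := by
    have hi : Integrable f₁ volume := (integrable_congr c1).2 ((integrable_indicator_iff hS).2 hint)
    have he : ∫ ξ, ‖f₁ ξ‖ = ∫ ξ in S, ‖f ξ‖ := by
      rw [← integral_indicator hS]
      refine integral_congr_ae (c1.mono fun x hx => ?_)
      simp only [hx, norm_indicator_eq_indicator_norm]
    filter_upwards [ae_norm_fourierInv_le f₁ hi] with x hx
    linarith
  set w : L2 N ℂ := 𝓕⁻ f₂ with hw
  have hw2 : ∫ x, ‖w x‖ ^ 2 ≤ M := by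
    rw [← norm_sq_eq_integral]
    have : ‖w‖ = ‖f₂‖ := by
      rw [← Lp.norm_fourier_eq w, hw, FourierTransform.fourier_fourierInv_eq]
    rw [this, norm_sq_eq_integral]
    refine le_trans (le_of_eq ?_) hhigh
    rw [← integral_indicator hS.compl]
    refine integral_congr_ae (c2.mono fun x hx => ?_)
    simp only [hx]
    by_cases h : x ∈ Sᶜ <;> simp [h]
  -- The low-frequency part is at most `t / 2`, so the high-frequency part must supply the other
  -- half.
  have hsub : volume {x | t < ‖u x‖} ≤ volume {x | t ^ 2 / 4 ≤ ‖w x‖ ^ 2} := by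
    refine measure_mono_ae ?_
    have ha := Lp.coeFn_add (𝓕⁻ f₁ : L2 N ℂ) w
    rw [← hu] at ha
    filter_upwards [ha, hb] with x hx hbx hxt
    have hxt : t < ‖u x‖ := hxt
    rw [hx] at hxt
    have := norm_add_le ((𝓕⁻ f₁ : L2 N ℂ) x) (w x)
    simp only [Pi.add_apply] at hxt
    have h3 : t / 2 ≤ ‖w x‖ := by linarith
    show t ^ 2 / 4 ≤ ‖w x‖ ^ 2
    nlinarith
  refine hsub.trans ?_
  have hche := mul_meas_ge_le_integral_of_nonneg
    (Filter.Eventually.of_forall fun x => sq_nonneg ‖w x‖) (integrable_norm_sq w) (t ^ 2 / 4)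
  have hfin : volume {x | t ^ 2 / 4 ≤ ‖w x‖ ^ 2} ≠ ⊤ :=
    ((integrable_norm_sq w).measure_ge_lt_top (by positivity)).ne
  rw [← ENNReal.ofReal_toReal hfin]
  refine ENNReal.ofReal_le_ofReal ?_
  rw [le_div_iff₀ (by positivity)]
  have h4 : t ^ 2 / 4 * (volume {x | t ^ 2 / 4 ≤ ‖w x‖ ^ 2}).toReal ≤ M := hche.trans hw2
  linarith

/-- Weak-type Sobolev inequality at the critical exponent `2N / (N - 1)`. -/
theorem exists_measure_lt_norm_le_rpow {N : ℕ} (hN : 1 < N) (m : ℝ) {K : ℝ} (hK : 0 < K) :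
    ∃ C : ℝ, 0 < C ∧ ∀ u : L2 N ℂ,
      Integrable (fun ξ => symbol m ξ ^ 2 * ‖(𝓕 u : L2 N ℂ) ξ‖ ^ 2) volume →
      ∫ ξ, symbol m ξ ^ 2 * ‖(𝓕 u : L2 N ℂ) ξ‖ ^ 2 ≤ K → ∀ t : ℝ, 0 < t →
      volume {x | t < ‖u x‖} ≤ ENNReal.ofReal (C * t ^ (-(2 * N / (N - 1) : ℝ))) := by
  obtain ⟨c, hc, hball⟩ := exists_integral_norm_inv_ball_le hN
  have hN1 : (0 : ℝ) < N - 1 := by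
    have : (1 : ℝ) < N := by exact_mod_cast hN
    linarith
  refine ⟨4 * K * (4 * K * c) ^ (1 / (N - 1) : ℝ), by positivity, fun u hi hu t ht => ?_⟩
  set f : L2 N ℂ := 𝓕 u with hf
  -- Chosen so that `K / t * (c * R ^ (N - 1)) = t / 4`, half of what the low frequencies may
  -- contribute.
  set R : ℝ := (t ^ 2 / (4 * K * c)) ^ (1 / (N - 1) : ℝ) with hR
  have hRpos : 0 < R := by positivity
  have hRpow : R ^ (N - 1) = t ^ 2 / (4 * K * c) := by
    rw [hR, ← Real.rpow_natCast, ← Real.rpow_mul (by positivity), Nat.cast_sub hN.le]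
    simp [hN1.ne']
  have hne : ∀ᵐ ξ : EuclideanSpace ℝ (Fin N), ξ ≠ 0 := by
    have : Nonempty (Fin N) := ⟨⟨0, by omega⟩⟩
    simp [ae_iff]
  -- AM-GM instead of Cauchy-Schwarz: it yields integrability on the ball and the bound `t / 4 + t /
  -- 4` at once.
  have hpt : ∀ᵐ ξ ∂(volume.restrict (Metric.ball (0 : EuclideanSpace ℝ (Fin N)) R)),
      ‖f ξ‖ ≤ K / t * ‖ξ‖⁻¹ + t / (4 * K) * (symbol m ξ ^ 2 * ‖f ξ‖ ^ 2) := by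
    filter_upwards [ae_restrict_of_ae hne] with ξ hξ
    have hn : 0 < ‖ξ‖ := norm_pos_iff.2 hξ
    have h1 : t / (4 * K) * (‖ξ‖ * ‖f ξ‖ ^ 2) ≤ t / (4 * K) * (symbol m ξ ^ 2 * ‖f ξ‖ ^ 2) := by
      gcongr
      exact norm_le_symbol_sq m ξ
    refine le_trans ?_ (add_le_add_right h1 _)
    have h2 : K / t * ‖ξ‖⁻¹ + t / (4 * K) * (‖ξ‖ * ‖f ξ‖ ^ 2) - ‖f ξ‖ =
        (4 * K * t * ‖ξ‖)⁻¹ * (2 * K - t * ‖ξ‖ * ‖f ξ‖) ^ 2 := by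
      field_simp
      ring
    have h3 : 0 ≤ (4 * K * t * ‖ξ‖)⁻¹ * (2 * K - t * ‖ξ‖ * ‖f ξ‖) ^ 2 := by positivity
    linarith
  have hidom : IntegrableOn (fun ξ => K / t * ‖ξ‖⁻¹ + t / (4 * K) * (symbol m ξ ^ 2 * ‖f ξ‖ ^ 2))
      (Metric.ball (0 : EuclideanSpace ℝ (Fin N)) R) volume :=
    ((integrableOn_norm_inv_ball hN R).const_mul _).add (hi.integrableOn.const_mul _)
  have hfint : IntegrableOn f (Metric.ball (0 : EuclideanSpace ℝ (Fin N)) R) volume :=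
    hidom.mono' (Lp.aestronglyMeasurable f).restrict hpt
  have hnn : ∀ ξ, 0 ≤ symbol m ξ ^ 2 * ‖f ξ‖ ^ 2 := fun ξ => by positivity
  have hlow : ∫ ξ in Metric.ball (0 : EuclideanSpace ℝ (Fin N)) R, ‖f ξ‖ ≤ t / 2 := by
    refine (integral_mono_ae hfint.norm hidom hpt).trans ?_
    rw [integral_add ((integrableOn_norm_inv_ball hN R).const_mul _)
      (hi.integrableOn.const_mul _), integral_const_mul, integral_const_mul]
    have h1 : ∫ ξ in Metric.ball (0 : EuclideanSpace ℝ (Fin N)) R, symbol m ξ ^ 2 * ‖f ξ‖ ^ 2 ≤ K :=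
      (setIntegral_le_integral hi (Filter.Eventually.of_forall hnn)).trans hu
    have h2 := hball R hRpos
    rw [hRpow] at h2
    calc _ ≤ K / t * (c * (t ^ 2 / (4 * K * c))) + t / (4 * K) * K := by gcongr
      _ = t / 2 := by field_simp; ring
  have hhigh : ∫ ξ in (Metric.ball (0 : EuclideanSpace ℝ (Fin N)) R)ᶜ, ‖f ξ‖ ^ 2 ≤ K / R := by
    have h1 : ∫ ξ in (Metric.ball (0 : EuclideanSpace ℝ (Fin N)) R)ᶜ, ‖f ξ‖ ^ 2 ≤
        ∫ ξ in (Metric.ball (0 : EuclideanSpace ℝ (Fin N)) R)ᶜ,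
          R⁻¹ * (symbol m ξ ^ 2 * ‖f ξ‖ ^ 2) := by
      refine setIntegral_mono_on (integrable_norm_sq f).integrableOn
        (hi.const_mul _).integrableOn measurableSet_ball.compl fun ξ hξ => ?_
      have h4 : R ≤ ‖ξ‖ := by simpa using hξ
      have h5 : R ≤ symbol m ξ ^ 2 := h4.trans (norm_le_symbol_sq m ξ)
      rw [← mul_assoc]
      refine le_mul_of_one_le_left (by positivity) ?_
      rw [inv_mul_eq_div, one_le_div hRpos]
      exact h5
    refine h1.trans ?_
    rw [integral_const_mul, div_eq_inv_mul]
    gcongr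
    exact (setIntegral_le_integral hi (Filter.Eventually.of_forall hnn)).trans hu
  refine (measure_lt_norm_le u measurableSet_ball ht hfint hlow hhigh).trans (le_of_eq ?_)
  congr 1
  have e1 : R = t ^ (2 / (N - 1) : ℝ) / (4 * K * c) ^ (1 / (N - 1) : ℝ) := by
    rw [hR, Real.div_rpow (by positivity) (by positivity), ← Real.rpow_natCast t 2,
      ← Real.rpow_mul ht.le]
    congr 2
    push_cast
    ring
  have e2 : t ^ (-(2 * N / (N - 1) : ℝ)) = (t ^ 2)⁻¹ * (t ^ (2 / (N - 1) : ℝ))⁻¹ := by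
    rw [← Real.rpow_natCast t 2, ← Real.rpow_neg ht.le, ← Real.rpow_neg ht.le,
      ← Real.rpow_add ht]
    congr 1
    push_cast
    field_simp
    ring
  rw [e1, e2]
  have : 0 < t ^ (2 / (N - 1) : ℝ) := by positivity
  have : 0 < (4 * K * c) ^ (1 / (N - 1) : ℝ) := by positivity
  field_simp

/-- Subcritical Sobolev embedding `H^{1/2} ⊂ L^q`, `2 ≤ q < 2N / (N - 1)`, as boundedness on
balls. -/
theorem exists_lintegral_rpow_norm_le {N : ℕ} (hN : 1 < N) (m : ℝ) {K q : ℝ} (hK : 0 < K)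
    (hq : 2 ≤ q) (hq' : q < 2 * N / (N - 1)) :
    ∃ C : ℝ, 0 < C ∧ ∀ u : L2 N ℂ,
      Integrable (fun ξ => symbol m ξ ^ 2 * ‖(𝓕 u : L2 N ℂ) ξ‖ ^ 2) volume →
      ∫ ξ, symbol m ξ ^ 2 * ‖(𝓕 u : L2 N ℂ) ξ‖ ^ 2 ≤ K → ‖u‖ ^ 2 ≤ K →
      ∫⁻ x, ENNReal.ofReal (‖u x‖ ^ q) ≤ ENNReal.ofReal C := by
  obtain ⟨C, hC, hweak⟩ := exists_measure_lt_norm_le_rpow hN m hK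
  set P : ℝ := 2 * N / (N - 1) with hP
  -- Subcriticality `q < P` enters here, making the exponent less than `-1`.
  have hIoi : IntegrableOn (fun t : ℝ => C * t ^ (-P + (q - 1))) (Set.Ioi 1) volume :=
    (integrableOn_Ioi_rpow_of_lt (by linarith) one_pos).const_mul _
  set J : ℝ := ∫ t in Set.Ioi (1 : ℝ), C * t ^ (-P + (q - 1)) with hJ
  have hJ0 : 0 ≤ J := setIntegral_nonneg measurableSet_Ioi fun t ht => by
    have : (0 : ℝ) < t := one_pos.trans ht
    positivity
  refine ⟨q * (K + J), by positivity, fun u hi hu hu2 => ?_⟩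
  have hnn : 0 ≤ᵐ[volume] fun x => ‖u x‖ := Filter.Eventually.of_forall fun x => norm_nonneg _
  have hmeas : AEMeasurable (fun x => ‖u x‖) volume := (Lp.aestronglyMeasurable u).norm.aemeasurable
  rw [lintegral_rpow_eq_lintegral_meas_lt_mul volume hnn hmeas (by linarith),
    ENNReal.ofReal_mul (by linarith)]
  refine mul_le_mul_right ?_ _
  -- Levels `t ≤ 1` are controlled by the `L²` norm, since `t ^ (q - 1) ≤ t` there; levels `t > 1`
  -- by the weak-type bound.
  rw [← Set.Ioc_union_Ioi_eq_Ioi zero_le_one,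
    lintegral_union measurableSet_Ioi (Set.Ioc_disjoint_Ioi le_rfl), ENNReal.ofReal_add hK.le hJ0]
  refine add_le_add ?_ ?_
  · have h2 := lintegral_rpow_eq_lintegral_meas_lt_mul volume hnn hmeas (p := 2) (by norm_num)
    have h3 : ∫⁻ x, ENNReal.ofReal (‖u x‖ ^ (2 : ℝ)) = ENNReal.ofReal (‖u‖ ^ 2) := by
      simp only [Real.rpow_two]
      rw [norm_sq_eq_integral, ofReal_integral_eq_lintegral_ofReal (integrable_norm_sq u)
        (Filter.Eventually.of_forall fun x => sq_nonneg _)]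
    calc ∫⁻ t in Set.Ioc (0 : ℝ) 1, volume {x | t < ‖u x‖} * ENNReal.ofReal (t ^ (q - 1))
        ≤ ∫⁻ t in Set.Ioc (0 : ℝ) 1, volume {x | t < ‖u x‖} * ENNReal.ofReal (t ^ (2 - 1 : ℝ)) := by
          refine setLIntegral_mono' measurableSet_Ioc fun t ht => ?_
          exact mul_le_mul_right (ENNReal.ofReal_le_ofReal
            (Real.rpow_le_rpow_of_exponent_ge ht.1 ht.2 (by linarith))) _
      _ ≤ ∫⁻ t in Set.Ioi (0 : ℝ), volume {x | t < ‖u x‖} * ENNReal.ofReal (t ^ (2 - 1 : ℝ)) :=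
          lintegral_mono_set fun t ht => ht.1
      _ ≤ ENNReal.ofReal 2 * ∫⁻ t in Set.Ioi (0 : ℝ),
            volume {x | t < ‖u x‖} * ENNReal.ofReal (t ^ (2 - 1 : ℝ)) :=
          le_mul_of_one_le_left zero_le (by simp)
      _ ≤ ENNReal.ofReal K := by
          rw [← h2, h3]
          exact ENNReal.ofReal_le_ofReal hu2
  · rw [hJ, ofReal_integral_eq_lintegral_ofReal hIoi]
    · refine setLIntegral_mono' measurableSet_Ioi fun t ht => ?_
      have ht0 : (0 : ℝ) < t := one_pos.trans ht
      refine (mul_le_mul_left (hweak u hi hu t ht0) _).trans (le_of_eq ?_)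
      rw [← ENNReal.ofReal_mul (by positivity), Real.rpow_add ht0, mul_assoc]
    · filter_upwards [self_mem_ae_restrict measurableSet_Ioi] with t ht
      have : (0 : ℝ) < t := one_pos.trans ht
      exact by positivity

/-! ### The norm of `X` on the Fourier side and the spectral gap -/

theorem ae_norm_toComplex {N : ℕ} {𝕜 : Type*} [RCLike 𝕜] (u : L2 N 𝕜) :
    ∀ᵐ x, ‖toComplex u x‖ = ‖u x‖ := by
  filter_upwards [(RCLike.map 𝕜 ℂ).coeFn_compLp u] with x hx
  rw [toComplex, hx, ← sq_eq_sq₀ (norm_nonneg _) (norm_nonneg _), RCLike.norm_sq_eq_def,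
    RCLike.norm_sq_eq_def]
  simp [RCLike.map_apply]

theorem norm_toComplex {N : ℕ} {𝕜 : Type*} [RCLike 𝕜] (u : L2 N 𝕜) : ‖toComplex u‖ = ‖u‖ := by
  rw [← sq_eq_sq₀ (norm_nonneg _) (norm_nonneg _), norm_sq_eq_integral, norm_sq_eq_integral]
  exact integral_congr_ae ((ae_norm_toComplex u).mono fun x hx => by simp only [hx])

theorem norm_symbolMul_sq {N : ℕ} {𝕜 : Type*} [RCLike 𝕜] (m : ℝ) (u : L2 N 𝕜)
    (ξ : EuclideanSpace ℝ (Fin N)) :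
    ‖symbolMul m u ξ‖ ^ 2 = symbol m ξ ^ 2 * ‖(𝓕 (toComplex u) : L2 N ℂ) ξ‖ ^ 2 := by
  simp [symbolMul, mul_pow]

theorem MemBessel.integrable {N : ℕ} {𝕜 : Type*} [RCLike 𝕜] {m : ℝ} {u : L2 N 𝕜}
    (h : MemBessel m u) :
    Integrable (fun ξ => symbol m ξ ^ 2 * ‖(𝓕 (toComplex u) : L2 N ℂ) ξ‖ ^ 2) volume := by
  have := MemLp.integrable_norm_pow h (by norm_num : (2 : ℕ) ≠ 0)
  simpa only [norm_symbolMul_sq] using this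

/-- Plancherel. -/
theorem MemBessel.integral_besselRoot {N : ℕ} {𝕜 : Type*} [RCLike 𝕜] {m : ℝ} {u : L2 N 𝕜}
    (h : MemBessel m u) :
    ∫ x, ‖besselRoot m u x‖ ^ 2 =
      ∫ ξ, symbol m ξ ^ 2 * ‖(𝓕 (toComplex u) : L2 N ℂ) ξ‖ ^ 2 := by
  rw [← norm_sq_eq_integral, besselRoot, dif_pos h]
  set g : L2 N ℂ := MemLp.toLp (symbolMul m u) h with hg
  rw [← Lp.norm_fourier_eq (𝓕⁻ g), FourierTransform.fourier_fourierInv_eq, norm_sq_eq_integral]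
  refine integral_congr_ae ((MemLp.coeFn_toLp h).mono fun x hx => ?_)
  simp only [hg, hx, norm_symbolMul_sq]

theorem lambda1_mul_le_normXSq {N : ℕ} {𝕜 : Type*} [RCLike 𝕜] {m : ℝ}
    {V : EuclideanSpace ℝ (Fin N) → ℝ} (hlam : 0 < lambda1 𝕜 m V) {u : L2 N 𝕜}
    (hu : u ∈ X 𝕜 m V) : lambda1 𝕜 m V * ‖u‖ ^ 2 ≤ normXSq m V u := by
  by_cases h0 : u = 0
  · subst h0
    rw [normXSq]
    simpa using integral_nonneg fun x => by positivity
  · have hn : 0 < ‖u‖ := norm_pos_iff.2 h0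
    -- The real `sInf` of a set unbounded below is 0, so positivity of `lambda1` already forces
    -- boundedness.
    have hbdd : BddBelow {q : ℝ | ∃ u ∈ X 𝕜 m V, u ≠ 0 ∧ q = normXSq m V u / ‖u‖ ^ 2} := by
      by_contra hb
      rw [lambda1, Real.sInf_of_not_bddBelow hb] at hlam
      exact lt_irrefl _ hlam
    have h1 : lambda1 𝕜 m V ≤ normXSq m V u / ‖u‖ ^ 2 := csInf_le hbdd ⟨u, hu, h0, rfl⟩
    rwa [le_div_iff₀ (by positivity)] at h1

theorem normXSq_nonneg {N : ℕ} {𝕜 : Type*} [RCLike 𝕜] {m : ℝ}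
    {V : EuclideanSpace ℝ (Fin N) → ℝ} (hlam : 0 < lambda1 𝕜 m V) {u : L2 N 𝕜}
    (hu : u ∈ X 𝕜 m V) : 0 ≤ normXSq m V u :=
  le_trans (by positivity) (lambda1_mul_le_normXSq hlam hu)

/-- A function whose integral controls all terms of the nonlinearity. -/
def control {N : ℕ} {𝕜 : Type*} [RCLike 𝕜] (q : ℝ) (V : EuclideanSpace ℝ (Fin N) → ℝ)
    (u : L2 N 𝕜) (x : EuclideanSpace ℝ (Fin N)) : ℝ :=
  ‖u x‖ ^ 2 + ‖u x‖ ^ q + max 0 (V x) * ‖u x‖ ^ 2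

theorem control_nonneg {N : ℕ} {𝕜 : Type*} [RCLike 𝕜] (q : ℝ) (V : EuclideanSpace ℝ (Fin N) → ℝ)
    (u : L2 N 𝕜) (x : EuclideanSpace ℝ (Fin N)) : 0 ≤ control q V u x := by
  unfold control
  positivity

/-- Since `V` may be negative, `normXSq` alone does not bound its two summands. The gap `l =
lambda1` gives `‖u‖ ^ 2 ≤ 1 / l`, so the negative part of `V` costs at most `B / l`; the kinetic
term and `∫ V⁺ |u|^2` are then each at most `1 + B / l`. -/
theorem exists_integral_control_le {N : ℕ} {𝕜 : Type*} [RCLike 𝕜] (hN : 1 < N) {m q B : ℝ}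
    {V : EuclideanSpace ℝ (Fin N) → ℝ} (hV : Continuous V) (hB : 0 < B) (hVB : ∀ x, -B < V x)
    (hlam : 0 < lambda1 𝕜 m V) (hq : 2 ≤ q) (hq' : q < 2 * N / (N - 1)) :
    ∃ C : ℝ, ∀ u ∈ X 𝕜 m V, normXSq m V u ≤ 1 →
      Integrable (control q V u) volume ∧ ∫ x, control q V u x ≤ C := by
  set l := lambda1 𝕜 m V with hl
  set K : ℝ := 1 + (B + 1) / l with hK
  obtain ⟨C, hC, hsob⟩ := exists_lintegral_rpow_norm_le hN m (K := K) (by positivity) hq hq'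
  refine ⟨K + C + K, fun u hu hu1 => ?_⟩
  have hl1 := lambda1_mul_le_normXSq hlam hu
  have hn : ‖u‖ ^ 2 ≤ 1 / l := by
    rw [le_div_iff₀ hlam]
    linarith
  have hBl : B * ‖u‖ ^ 2 ≤ B / l := by
    calc _ ≤ B * (1 / l) := by gcongr
      _ = _ := by ring
  have hKe : K = 1 + B / l + 1 / l := by rw [hK]; ring
  have h1l : 0 < 1 / l := by positivity
  have hBl0 : 0 < B / l := by positivity
  have hX : normXSq m V u = (∫ ξ, symbol m ξ ^ 2 * ‖(𝓕 (toComplex u) : L2 N ℂ) ξ‖ ^ 2) +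
      ∫ x, V x * ‖u x‖ ^ 2 := by
    rw [normXSq, hu.1.integral_besselRoot]
  have hS0 : 0 ≤ ∫ ξ, symbol m ξ ^ 2 * ‖(𝓕 (toComplex u) : L2 N ℂ) ξ‖ ^ 2 :=
    integral_nonneg fun ξ => by positivity
  have i1 := integrable_norm_sq u
  have i3 : Integrable (fun x => max 0 (V x) * ‖u x‖ ^ 2) volume := by
    refine (hu.2.norm).mono' ?_ (Filter.Eventually.of_forall fun x => ?_)
    · exact (continuous_const.max hV).aestronglyMeasurable.mul i1.aestronglyMeasurable
    · rw [norm_mul, norm_mul]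
      gcongr
      rw [Real.norm_eq_abs, Real.norm_eq_abs, abs_of_nonneg (le_max_left _ _)]
      exact max_le (abs_nonneg _) (le_abs_self _)
  have hsum : ∫ x, max 0 (V x) * ‖u x‖ ^ 2 ≤ (∫ x, V x * ‖u x‖ ^ 2) + B * ‖u‖ ^ 2 := by
    rw [norm_sq_eq_integral, ← integral_const_mul, ← integral_add hu.2 (i1.const_mul _)]
    refine integral_mono i3 (hu.2.add (i1.const_mul _)) fun x => ?_
    have : max 0 (V x) ≤ V x + B := max_le (by linarith [hVB x]) (by linarith)
    calc _ ≤ (V x + B) * ‖u x‖ ^ 2 := by gcongr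
      _ = _ := by ring
  have hp0 : 0 ≤ ∫ x, max 0 (V x) * ‖u x‖ ^ 2 := integral_nonneg fun x => by positivity
  have hlint : ∫⁻ x, ENNReal.ofReal (‖u x‖ ^ q) ≤ ENNReal.ofReal C := by
    have h := hsob (toComplex u) hu.1.integrable (by linarith) (by
      rw [norm_toComplex]; linarith)
    refine le_trans (le_of_eq ?_) h
    exact lintegral_congr_ae ((ae_norm_toComplex u).mono fun x hx => by simp only [hx])
  have hmeas : AEStronglyMeasurable (fun x => ‖u x‖ ^ q) volume :=
    ((Lp.aestronglyMeasurable u).norm.aemeasurable.pow_const q).aestronglyMeasurable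
  have hq0 : 0 ≤ᵐ[volume] fun x => ‖u x‖ ^ q := Filter.Eventually.of_forall fun x => by positivity
  have i2 : Integrable (fun x => ‖u x‖ ^ q) volume :=
    (lintegral_ofReal_ne_top_iff_integrable hmeas hq0).1
      (ne_top_of_le_ne_top ENNReal.ofReal_ne_top hlint)
  have hi2 : ∫ x, ‖u x‖ ^ q ≤ C := by
    rw [integral_eq_lintegral_of_nonneg_ae hq0 hmeas]
    exact ENNReal.toReal_le_of_le_ofReal hC.le hlint
  have i12 : Integrable (fun x => ‖u x‖ ^ 2 + ‖u x‖ ^ q) volume := i1.add i2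
  refine ⟨i12.add i3, ?_⟩
  have : ∫ x, control q V u x = (∫ x, ‖u x‖ ^ 2) + (∫ x, ‖u x‖ ^ q) +
      ∫ x, max 0 (V x) * ‖u x‖ ^ 2 := by
    unfold control
    rw [integral_add i12 i3, integral_add i1 i2]
  rw [this, ← norm_sq_eq_integral]
  linarith

/-! ### Pointwise inequalities -/

theorem rpow_le_sq_add_rpow {y t q : ℝ} (hy : 0 ≤ y) (ht : 2 ≤ t) (htq : t ≤ q) :
    y ^ t ≤ y ^ 2 + y ^ q := by
  rcases hy.eq_or_lt with rfl | hy0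
  · rw [Real.zero_rpow (by linarith)]
    positivity
  have h1 : 0 ≤ y ^ q := by positivity
  rcases le_total y 1 with h | h
  · have := Real.rpow_le_rpow_of_exponent_ge hy0 h ht
    rw [Real.rpow_two] at this
    linarith
  · have := Real.rpow_le_rpow_of_exponent_le h htq
    nlinarith [sq_nonneg y]

/-- AM-GM with weights `1 / β` and `1 - 1 / β`, applied to `v * y ^ 2` and the power of `y` that
makes the product `v ^ (1 / β) * y ^ t`. Separating `t` from `τ` lets one exponent on the right
serve both `t = p` and `t = p * s`. -/
theorem one_add_rpow_mul_rpow_le {v y t τ β : ℝ} (hβ : 1 < β) (hv : 0 ≤ v) (hy : 0 ≤ y)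
    (ht : 2 ≤ t) (htτ : t ≤ τ) :
    (1 + v ^ (1 / β)) * y ^ t ≤
      2 * (y ^ 2 + y ^ ((τ * β - 2) / (β - 1)) + v * y ^ 2) := by
  have hβ1 : 0 < β - 1 := by linarith
  have hq : t ≤ (τ * β - 2) / (β - 1) := by
    rw [le_div_iff₀ hβ1]
    nlinarith
  have h1 := rpow_le_sq_add_rpow hy ht hq
  have hq1 : 2 ≤ (t * β - 2) / (β - 1) := by
    rw [le_div_iff₀ hβ1]
    nlinarith
  have hq2 : (t * β - 2) / (β - 1) ≤ (τ * β - 2) / (β - 1) := by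
    gcongr
  have h2 := rpow_le_sq_add_rpow hy hq1 hq2
  have h3 : v ^ (1 / β) * y ^ t ≤ v * y ^ 2 + y ^ ((t * β - 2) / (β - 1)) := by
    have hg := Real.geom_mean_le_arith_mean2_weighted (w₁ := 1 / β) (w₂ := 1 - 1 / β)
      (p₁ := v * y ^ 2) (p₂ := y ^ ((t * β - 2) / (β - 1))) (by positivity)
      (by rw [sub_nonneg, div_le_one (by linarith)]; exact hβ.le) (by positivity) (by positivity)
      (by ring)
    have he : (v * y ^ 2) ^ (1 / β) * (y ^ ((t * β - 2) / (β - 1))) ^ (1 - 1 / β) =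
        v ^ (1 / β) * y ^ t := by
      rw [Real.mul_rpow hv (by positivity), ← Real.rpow_natCast y 2, ← Real.rpow_mul hy,
        ← Real.rpow_mul hy, mul_assoc]
      have hpos : 0 < t - 2 * (1 / β) := by
        have : 1 / β < 1 := by rw [div_lt_one (by linarith)]; exact hβ
        linarith
      have hβ0 : β ≠ 0 := by linarith
      have e : (t * β - 2) / (β - 1) * (1 - 1 / β) = t - 2 * (1 / β) := by
        field_simp
      rw [e, ← Real.rpow_add_of_nonneg hy (by positivity) hpos.le]
      congr 2
      push_cast
      ring
    rw [he] at hg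
    refine hg.trans ?_
    have hw1 : 1 / β ≤ 1 := by rw [div_le_one (by linarith)]; exact hβ.le
    have hw0 : 0 ≤ 1 / β := by positivity
    have a1 : 0 ≤ v * y ^ 2 := by positivity
    have a2 : 0 ≤ y ^ ((t * β - 2) / (β - 1)) := by positivity
    nlinarith
  have a1 : 0 ≤ v * y ^ 2 := by positivity
  linarith

/-- The pointwise form of Young's inequality for convolutions. -/
theorem mul_mul_le_young {r w a b : ℝ} (hr : 1 < r) (hw : 0 ≤ w) (ha : 0 ≤ a) (hb : 0 ≤ b) :
    w * a * b ≤ a ^ (2 * r / (2 * r - 1)) * b ^ (2 * r / (2 * r - 1)) +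
      w ^ r * a ^ (2 * r / (2 * r - 1)) + w ^ r * b ^ (2 * r / (2 * r - 1)) := by
  set s := 2 * r / (2 * r - 1) with hs
  have hs0 : 0 < s := div_pos (by linarith) (by linarith)
  have hr0 : 0 < r := by linarith
  have hr1 : 1 / r < 1 := by rw [div_lt_one hr0]; exact hr
  -- These weights give `w` total exponent 1; the value of `s` is the one giving `a` and `b`
  -- exponent 1 too.
  have hg := Real.geom_mean_le_arith_mean3_weighted (w₁ := 1 - 1 / r) (w₂ := 1 / (2 * r))
    (w₃ := 1 / (2 * r)) (p₁ := a ^ s * b ^ s) (p₂ := w ^ r * a ^ s) (p₃ := w ^ r * b ^ s)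
    (by linarith) (by positivity) (by positivity) (by positivity) (by positivity) (by positivity)
    (by field_simp; ring)
  have key : ∀ c : ℝ, 0 ≤ c → c ^ (s * (1 - 1 / r)) * c ^ (s * (1 / (2 * r))) = c := by
    intro c hc
    rw [← Real.rpow_add_of_nonneg hc (mul_nonneg hs0.le (by linarith)) (by positivity)]
    have : s * (1 - 1 / r) + s * (1 / (2 * r)) = 1 := by
      have : 2 * r - 1 ≠ 0 := by linarith
      rw [hs]
      field_simp
      ring
    rw [this, Real.rpow_one]
  have keyw : w ^ (r * (1 / (2 * r))) * w ^ (r * (1 / (2 * r))) = w := by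
    rw [← Real.rpow_add_of_nonneg hw (by positivity) (by positivity)]
    have : r * (1 / (2 * r)) + r * (1 / (2 * r)) = 1 := by
      field_simp
      norm_num
    rw [this, Real.rpow_one]
  have he : (a ^ s * b ^ s) ^ (1 - 1 / r) * (w ^ r * a ^ s) ^ (1 / (2 * r)) *
      (w ^ r * b ^ s) ^ (1 / (2 * r)) = w * a * b := by
    rw [Real.mul_rpow (by positivity) (by positivity), Real.mul_rpow (by positivity) (by positivity),
      Real.mul_rpow (by positivity) (by positivity), ← Real.rpow_mul ha, ← Real.rpow_mul hb,
      ← Real.rpow_mul hw, ← Real.rpow_mul ha, ← Real.rpow_mul hb]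
    calc _ = (w ^ (r * (1 / (2 * r))) * w ^ (r * (1 / (2 * r)))) *
          (a ^ (s * (1 - 1 / r)) * a ^ (s * (1 / (2 * r)))) *
          (b ^ (s * (1 - 1 / r)) * b ^ (s * (1 / (2 * r)))) := by ring
      _ = _ := by rw [keyw, key a ha, key b hb]
  rw [he] at hg
  refine hg.trans ?_
  have h2r : 1 / (2 * r) ≤ 1 := by rw [div_le_one (by linarith)]; linarith
  have h1r : 0 < 1 / r := by positivity
  refine add_le_add (add_le_add ?_ ?_) ?_
  · exact mul_le_of_le_one_left (by positivity) (by linarith)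
  · exact mul_le_of_le_one_left (by positivity) h2r
  · exact mul_le_of_le_one_left (by positivity) h2r

/-! ### The weight, convolution integrals and the bound on the nonlocal term -/

theorem exists_ae_norm_le_of_memLp_top {α : Type*} [MeasurableSpace α] {μ : Measure α} {f : α → ℝ}
    (hf : MemLp f ⊤ μ) : ∃ M : ℝ, ∀ᵐ x ∂μ, ‖f x‖ ≤ M := by
  refine ⟨(eLpNorm f ⊤ μ).toReal, ?_⟩
  rw [eLpNorm_exponent_top]
  filter_upwards [ae_le_eLpNormEssSup (f := f) (μ := μ)] with x hx
  have h := hf.2.ne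
  rw [eLpNorm_exponent_top] at h
  simpa using ENNReal.toReal_mono h hx

theorem exists_ae_rpow_le {N : ℕ} {β s : ℝ} {V A : EuclideanSpace ℝ (Fin N) → ℝ} (hs : 0 < s)
    (hA_loc : ∀ K : Set (EuclideanSpace ℝ (Fin N)), IsCompact K →
      MemLp A ⊤ (volume.restrict K))
    (hA_one : ∀ᵐ x, 1 ≤ A x)
    (hAV : ∃ C₀ R₀ : ℝ, 0 < C₀ ∧ 0 < R₀ ∧ ∀ᵐ x : EuclideanSpace ℝ (Fin N), R₀ < ‖x‖ →
      A x ^ s ≤ C₀ * (1 + max 0 (V x) ^ (1 / β))) :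
    ∃ C : ℝ, 0 < C ∧ ∀ᵐ x, A x ^ s ≤ C * (1 + max 0 (V x) ^ (1 / β)) := by
  obtain ⟨C₀, R₀, hC, hR, h⟩ := hAV
  obtain ⟨M, hM⟩ : ∃ M : ℝ, ∀ᵐ x ∂(volume.restrict
      (Metric.closedBall (0 : EuclideanSpace ℝ (Fin N)) R₀)), ‖A x‖ ≤ M :=
    exists_ae_norm_le_of_memLp_top (hA_loc _ (isCompact_closedBall _ _))
  rw [ae_restrict_iff' Metric.isClosed_closedBall.measurableSet] at hM
  refine ⟨C₀ + |M| ^ s, by positivity, ?_⟩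
  filter_upwards [h, hM, hA_one] with x h1 h2 h3
  have hv : 0 ≤ max 0 (V x) ^ (1 / β) := by positivity
  have hMs : 0 ≤ |M| ^ s := by positivity
  by_cases hx : R₀ < ‖x‖
  · nlinarith [h1 hx]
  · have h4 := h2 (by simpa using hx)
    rw [Real.norm_eq_abs, abs_of_nonneg (by linarith)] at h4
    have h5 : A x ^ s ≤ |M| ^ s :=
      Real.rpow_le_rpow (by linarith) (h4.trans (le_abs_self M)) hs.le
    nlinarith

theorem aestronglyMeasurable_of_forall_isCompact {N : ℕ} {A : EuclideanSpace ℝ (Fin N) → ℝ}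
    (hA_loc : ∀ K : Set (EuclideanSpace ℝ (Fin N)), IsCompact K →
      MemLp A ⊤ (volume.restrict K)) : AEStronglyMeasurable A volume := by
  have h : AEStronglyMeasurable A (volume.restrict
      (⋃ n : ℕ, Metric.closedBall (0 : EuclideanSpace ℝ (Fin N)) n)) :=
    aestronglyMeasurable_iUnion_iff.2 fun n => (hA_loc _ (isCompact_closedBall _ _)).1
  rwa [Metric.iUnion_closedBall_nat, Measure.restrict_univ] at h

/-- The shear `(x, y) ↦ (x, y - x)` preserves the measure and turns the integrand into a tensor
product. -/
theorem integrable_sub_mul_fst {N : ℕ} {w g : EuclideanSpace ℝ (Fin N) → ℝ}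
    (hw : Integrable w volume) (hg : Integrable g volume) :
    Integrable (fun z : EuclideanSpace ℝ (Fin N) × EuclideanSpace ℝ (Fin N) =>
      w (z.1 - z.2) * g z.1) volume ∧
    ∫ z : EuclideanSpace ℝ (Fin N) × EuclideanSpace ℝ (Fin N), w (z.1 - z.2) * g z.1 =
      (∫ x, g x) * ∫ x, w x := by
  have hmp := measurePreserving_prod_sub
    (volume : Measure (EuclideanSpace ℝ (Fin N))) (volume : Measure (EuclideanSpace ℝ (Fin N)))
  have hi := hg.mul_prod hw.comp_neg
  have e : (fun z : EuclideanSpace ℝ (Fin N) × EuclideanSpace ℝ (Fin N) =>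
      w (z.1 - z.2) * g z.1) = (fun z => g z.1 * w (-z.2)) ∘ fun z => (z.1, z.2 - z.1) := by
    funext z
    simp [mul_comm]
  rw [Measure.volume_eq_prod, e]
  refine ⟨hmp.integrable_comp_of_integrable hi, ?_⟩
  have := integral_map hmp.measurable.aemeasurable (f := fun z => g z.1 * w (-z.2))
    (by rw [hmp.map_eq]; exact hi.aestronglyMeasurable)
  rw [hmp.map_eq] at this
  simp only [Function.comp_def]
  rw [← this, integral_prod_mul g (fun y => w (-y)), integral_neg_eq_self]

theorem integrable_sub_mul_snd {N : ℕ} {w g : EuclideanSpace ℝ (Fin N) → ℝ}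
    (hw : Integrable w volume) (hg : Integrable g volume) :
    Integrable (fun z : EuclideanSpace ℝ (Fin N) × EuclideanSpace ℝ (Fin N) =>
      w (z.1 - z.2) * g z.2) volume ∧
    ∫ z : EuclideanSpace ℝ (Fin N) × EuclideanSpace ℝ (Fin N), w (z.1 - z.2) * g z.2 =
      (∫ x, w x) * ∫ x, g x := by
  have hmp := measurePreserving_sub_prod
    (volume : Measure (EuclideanSpace ℝ (Fin N))) (volume : Measure (EuclideanSpace ℝ (Fin N)))
  have hi := hw.mul_prod hg
  have e : (fun z : EuclideanSpace ℝ (Fin N) × EuclideanSpace ℝ (Fin N) =>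
      w (z.1 - z.2) * g z.2) = (fun z => w z.1 * g z.2) ∘ fun z => (z.1 - z.2, z.2) := by
    funext z
    simp
  rw [Measure.volume_eq_prod, e]
  refine ⟨hmp.integrable_comp_of_integrable hi, ?_⟩
  have := integral_map hmp.measurable.aemeasurable (f := fun z => w z.1 * g z.2)
    (by rw [hmp.map_eq]; exact hi.aestronglyMeasurable)
  rw [hmp.map_eq] at this
  simp only [Function.comp_def]
  rw [← this, integral_prod_mul]

theorem quasiMeasurePreserving_sub_prod (N : ℕ) : Measure.QuasiMeasurePreserving
    (fun z : EuclideanSpace ℝ (Fin N) × EuclideanSpace ℝ (Fin N) => z.1 - z.2) :=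
  quasiMeasurePreserving_sub volume volume

theorem aestronglyMeasurable_nonlocalIntegrand {N : ℕ} {𝕜 : Type*} [RCLike 𝕜] {p : ℝ}
    {A W : EuclideanSpace ℝ (Fin N) → ℝ} (hA : AEStronglyMeasurable A volume)
    (hW : AEStronglyMeasurable W volume) (u : L2 N 𝕜) :
    AEStronglyMeasurable (nonlocalIntegrand p A W u) volume := by
  have hu : AEStronglyMeasurable (fun x => ‖u x‖ ^ p) volume :=
    ((Lp.aestronglyMeasurable u).norm.aemeasurable.pow_const p).aestronglyMeasurable
  exact (((hW.comp_quasiMeasurePreserving (quasiMeasurePreserving_sub_prod N)).mul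
    hA.comp_fst).mul hu.comp_fst).mul hu.comp_snd

theorem exists_nonlocalTerm_le {N : ℕ} {𝕜 : Type*} [RCLike 𝕜] (hN : 1 < N) {m p β r B : ℝ}
    {V A W : EuclideanSpace ℝ (Fin N) → ℝ} (hβ : 1 < β) (hp : 2 ≤ p)
    (hp' : p < 2 * (N * β - 1) / (β * (N - 1)))
    (hr : max 1 ((1 - N * β) / (2 + β * N * (p - 2) - β * p)) < r)
    (hA_loc : ∀ K : Set (EuclideanSpace ℝ (Fin N)), IsCompact K →
      MemLp A ⊤ (volume.restrict K))
    (hA_one : ∀ᵐ x, 1 ≤ A x)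
    (hV : Continuous V) (hB : 0 < B) (hVB : ∀ x, -B < V x)
    (hlam : 0 < lambda1 𝕜 m V)
    (hAV : ∃ C₀ R₀ : ℝ, 0 < C₀ ∧ 0 < R₀ ∧ ∀ᵐ x : EuclideanSpace ℝ (Fin N), R₀ < ‖x‖ →
      A x ^ (2 * r / (2 * r - 1)) ≤ C₀ * (1 + max 0 (V x) ^ (1 / β)))
    (hW : ∃ W₁ W₂ : EuclideanSpace ℝ (Fin N) → ℝ,
      MemLp W₁ (ENNReal.ofReal r) volume ∧ MemLp W₂ ⊤ volume ∧ ∀ᵐ x, W x = W₁ x + W₂ x) :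
    ∃ C : ℝ, ∀ u ∈ X 𝕜 m V, normXSq m V u ≤ 1 →
      Integrable (nonlocalIntegrand p A W u) volume ∧ nonlocalTerm p A W u ≤ C := by
  obtain ⟨W₁, W₂, hW₁, hW₂, hWe⟩ := hW
  have hr1 : 1 < r := (le_max_left _ _).trans_lt hr
  have hr2 := (le_max_right _ _).trans_lt hr
  set s := 2 * r / (2 * r - 1) with hs
  have hs1 : 1 < s := by
    rw [hs, lt_div_iff₀ (by linarith)]
    linarith
  have hNr : (1 : ℝ) < N := by exact_mod_cast hN
  set q := (p * s * β - 2) / (β - 1) with hq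
  have hps : 2 ≤ p * s := by nlinarith
  have hq2 : 2 ≤ q := by
    rw [hq, le_div_iff₀ (by linarith)]
    nlinarith
  -- The bound on `p` says that the denominator in the condition on `r` is negative; after both
  -- signs are flipped, that condition unwinds to this inequality.
  have hq' : q < 2 * N / (N - 1) := by
    have hD : 0 < β * p - 2 - β * N * (p - 2) := by
      rw [lt_div_iff₀ (by nlinarith)] at hp'
      nlinarith
    have hr3 : N * β - 1 < r * (β * p - 2 - β * N * (p - 2)) := by
      rw [← neg_div_neg_eq, div_lt_iff₀ (by linarith)] at hr2
      linarith
    have h4 : p * s * (β * (N - 1)) < 2 * (N * β - 1) := by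
      rw [hs, mul_div_assoc', div_mul_eq_mul_div, div_lt_iff₀ (by linarith)]
      nlinarith
    rw [hq, div_lt_div_iff₀ (by linarith) (by linarith)]
    nlinarith
  obtain ⟨C₁, hC₁, hA⟩ := exists_ae_rpow_le (by linarith) hA_loc hA_one hAV
  obtain ⟨G, hG⟩ := exists_integral_control_le (𝕜 := 𝕜) hN hV hB hVB hlam hq2 hq'
  have hAm := aestronglyMeasurable_of_forall_isCompact hA_loc
  have hWm : AEStronglyMeasurable W volume :=
    (hW₁.1.add hW₂.1).congr (hWe.mono fun x hx => hx.symm)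
  obtain ⟨M, hM⟩ := exists_ae_norm_le_of_memLp_top hW₂
  have hWr : Integrable (fun x => ‖W₁ x‖ ^ r) volume := by
    have := hW₁.integrable_norm_rpow (by simpa using one_pos.trans hr1) ENNReal.ofReal_ne_top
    rwa [ENNReal.toReal_ofReal (by linarith)] at this
  set D : ℝ := C₁ * 2 with hD
  have hD0 : 0 < D := by positivity
  refine ⟨(|M| + 1) * D ^ 2 * G ^ 2 + 2 * D * ((∫ x, ‖W₁ x‖ ^ r) * G), fun u hu hu1 => ?_⟩
  obtain ⟨hGi, hGle⟩ := hG u hu hu1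
  have hG0 : 0 ≤ ∫ x, control q V u x := integral_nonneg (control_nonneg q V u)
  have hw0 : 0 ≤ ∫ x, ‖W₁ x‖ ^ r := integral_nonneg fun x => by positivity
  -- The first power of `A |u|^p` serves the bounded part `W₂`, its power `s` the part `W₁`.
  have hpt : ∀ᵐ x, ‖u x‖ ^ p ≤ A x * ‖u x‖ ^ p ∧ 1 ≤ A x ∧ A x * ‖u x‖ ^ p ≤ D * control q V u x ∧
      (A x * ‖u x‖ ^ p) ^ s ≤ D * control q V u x := by
    filter_upwards [hA, hA_one] with x hx hx1
    have hy : 0 ≤ ‖u x‖ := norm_nonneg _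
    have hup : 0 ≤ ‖u x‖ ^ p := by positivity
    have hv : 0 ≤ max 0 (V x) := le_max_left _ _
    have key : ∀ t : ℝ, 2 ≤ t → t ≤ p * s → A x ^ s * ‖u x‖ ^ t ≤ D * control q V u x := by
      intro t ht hts
      have h1 := one_add_rpow_mul_rpow_le hβ hv hy ht hts
      calc A x ^ s * ‖u x‖ ^ t ≤ C₁ * (1 + max 0 (V x) ^ (1 / β)) * ‖u x‖ ^ t := by gcongr
        _ = C₁ * ((1 + max 0 (V x) ^ (1 / β)) * ‖u x‖ ^ t) := by ring
        _ ≤ C₁ * (2 * control q V u x) := by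
          exact mul_le_mul_of_nonneg_left h1 hC₁.le
        _ = _ := by rw [hD]; ring
    refine ⟨le_mul_of_one_le_left hup hx1, hx1, ?_, ?_⟩
    · refine le_trans ?_ (key p hp (by nlinarith))
      gcongr
      exact Real.self_le_rpow_of_one_le hx1 hs1.le
    · rw [Real.mul_rpow (by linarith) hup, ← Real.rpow_mul hy]
      exact key (p * s) hps le_rfl
  have hpt1 : ∀ᵐ z : EuclideanSpace ℝ (Fin N) × EuclideanSpace ℝ (Fin N), _ :=
    Measure.quasiMeasurePreserving_fst.ae hpt
  have hpt2 : ∀ᵐ z : EuclideanSpace ℝ (Fin N) × EuclideanSpace ℝ (Fin N), _ :=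
    Measure.quasiMeasurePreserving_snd.ae hpt
  have hW' := (quasiMeasurePreserving_sub_prod N).ae (hWe.and hM)
  set H : EuclideanSpace ℝ (Fin N) × EuclideanSpace ℝ (Fin N) → ℝ := fun z =>
    (|M| + 1) * D ^ 2 * (control q V u z.1 * control q V u z.2) +
      D * (‖W₁ (z.1 - z.2)‖ ^ r * control q V u z.1) +
      D * (‖W₁ (z.1 - z.2)‖ ^ r * control q V u z.2) with hH
  have hbound : ∀ᵐ z, ‖nonlocalIntegrand p A W u z‖ ≤ H z := by
    filter_upwards [hpt1, hpt2, hW'] with z h1 h2 h3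
    obtain ⟨h1a, h1b, h1c, h1d⟩ := h1
    obtain ⟨h2a, h2b, h2c, h2d⟩ := h2
    obtain ⟨h3a, h3b⟩ := h3
    have g1 := control_nonneg q V u z.1
    have g2 := control_nonneg q V u z.2
    have up1 : 0 ≤ ‖u z.1‖ ^ p := by positivity
    have up2 : 0 ≤ ‖u z.2‖ ^ p := by positivity
    set a := A z.1 * ‖u z.1‖ ^ p with ha
    set b := A z.2 * ‖u z.2‖ ^ p with hb
    have ha0 : 0 ≤ a := up1.trans h1a
    have hb0 : 0 ≤ b := up2.trans h2a
    have hw : ‖W (z.1 - z.2)‖ ≤ ‖W₁ (z.1 - z.2)‖ + |M| := by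
      rw [h3a]
      refine (norm_add_le _ _).trans ?_
      gcongr
      exact h3b.trans (le_abs_self M)
    have hy := mul_mul_le_young hr1 (norm_nonneg (W₁ (z.1 - z.2))) ha0 hb0
    rw [← hs] at hy
    calc ‖nonlocalIntegrand p A W u z‖ = ‖W (z.1 - z.2)‖ * a * ‖u z.2‖ ^ p := by
          rw [nonlocalIntegrand, norm_mul, norm_mul, norm_mul, Real.norm_of_nonneg up1,
            Real.norm_of_nonneg up2, Real.norm_of_nonneg (by linarith : 0 ≤ A z.1), ha]
          ring
      _ ≤ (‖W₁ (z.1 - z.2)‖ + |M|) * a * b := by gcongr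
      _ = ‖W₁ (z.1 - z.2)‖ * a * b + |M| * (a * b) := by ring
      _ ≤ (a ^ s * b ^ s + ‖W₁ (z.1 - z.2)‖ ^ r * a ^ s + ‖W₁ (z.1 - z.2)‖ ^ r * b ^ s) +
          |M| * (a * b) := by gcongr
      _ ≤ ((D * control q V u z.1) * (D * control q V u z.2) +
          ‖W₁ (z.1 - z.2)‖ ^ r * (D * control q V u z.1) +
          ‖W₁ (z.1 - z.2)‖ ^ r * (D * control q V u z.2)) +
          |M| * ((D * control q V u z.1) * (D * control q V u z.2)) := by gcongr
      _ = H z := by rw [hH]; ring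
  have i1 : Integrable (fun z : EuclideanSpace ℝ (Fin N) × EuclideanSpace ℝ (Fin N) =>
      control q V u z.1 * control q V u z.2) volume := hGi.mul_prod hGi
  obtain ⟨i2, e2⟩ := integrable_sub_mul_fst hWr hGi
  obtain ⟨i3, e3⟩ := integrable_sub_mul_snd hWr hGi
  have i12 : Integrable (fun z : EuclideanSpace ℝ (Fin N) × EuclideanSpace ℝ (Fin N) =>
      (|M| + 1) * D ^ 2 * (control q V u z.1 * control q V u z.2) +
      D * (‖W₁ (z.1 - z.2)‖ ^ r * control q V u z.1)) volume :=
    (i1.const_mul _).add (i2.const_mul _)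
  have hHi : Integrable H volume := i12.add (i3.const_mul _)
  have hint : Integrable (nonlocalIntegrand p A W u) volume :=
    hHi.mono' (aestronglyMeasurable_nonlocalIntegrand hAm hWm u) hbound
  refine ⟨hint, ?_⟩
  calc nonlocalTerm p A W u ≤ ∫ z, H z :=
        integral_mono_ae hint hHi (hbound.mono fun z hz => (le_abs_self _).trans hz)
    _ = (|M| + 1) * D ^ 2 * (∫ x, control q V u x) ^ 2 +
        2 * D * ((∫ x, ‖W₁ x‖ ^ r) * ∫ x, control q V u x) := by
        rw [hH, integral_add i12 (i3.const_mul _), integral_add (i1.const_mul _) (i2.const_mul _),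
          integral_const_mul, integral_const_mul, integral_const_mul, e2, e3,
          Measure.volume_eq_prod, integral_prod_mul]
        ring
    _ ≤ _ := by gcongr

/-! ### Homogeneity -/

theorem toComplex_smul {N : ℕ} {𝕜 : Type*} [RCLike 𝕜] (c : ℝ) (u : L2 N 𝕜) :
    toComplex (c • u) = (c : ℂ) • toComplex u := by
  have h : toComplex (c • u) = c • toComplex u :=
    ((RCLike.map 𝕜 ℂ).compLpₗ 2 volume).map_smul c u
  rw [h]
  ext1
  filter_upwards [Lp.coeFn_smul c (toComplex u), Lp.coeFn_smul (c : ℂ) (toComplex u)] with x h1 h2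
  rw [h1, h2]
  simp

theorem symbolMul_smul {N : ℕ} {𝕜 : Type*} [RCLike 𝕜] (m c : ℝ) (u : L2 N 𝕜) :
    symbolMul m (c • u) =ᵐ[volume] (c : ℂ) • symbolMul m u := by
  have h : (𝓕 (toComplex (c • u)) : L2 N ℂ) = (c : ℂ) • (𝓕 (toComplex u) : L2 N ℂ) := by
    rw [toComplex_smul, FourierTransform.fourier_smul]
  filter_upwards [Lp.coeFn_smul (c : ℂ) (𝓕 (toComplex u) : L2 N ℂ)] with x hx
  simp only [symbolMul, h, hx, Pi.smul_apply, smul_eq_mul]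
  ring

theorem ae_norm_smul {N : ℕ} {𝕜 : Type*} [RCLike 𝕜] (c : ℝ) (u : L2 N 𝕜) :
    ∀ᵐ x, ‖(c • u : L2 N 𝕜) x‖ = |c| * ‖u x‖ := by
  filter_upwards [Lp.coeFn_smul c u] with x hx
  rw [hx, Pi.smul_apply, norm_smul, Real.norm_eq_abs]

theorem ae_mul_norm_smul_sq {N : ℕ} {𝕜 : Type*} [RCLike 𝕜] (V : EuclideanSpace ℝ (Fin N) → ℝ)
    (c : ℝ) (u : L2 N 𝕜) :
    (fun x => V x * ‖(c • u : L2 N 𝕜) x‖ ^ 2) =ᵐ[volume] fun x => c ^ 2 * (V x * ‖u x‖ ^ 2) := by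
  filter_upwards [ae_norm_smul c u] with x hx
  rw [hx, mul_pow, sq_abs]
  ring

theorem smul_mem_X {N : ℕ} {𝕜 : Type*} [RCLike 𝕜] {m : ℝ} {V : EuclideanSpace ℝ (Fin N) → ℝ}
    (c : ℝ) {u : L2 N 𝕜} (hu : u ∈ X 𝕜 m V) : c • u ∈ X 𝕜 m V :=
  ⟨(memLp_congr_ae (symbolMul_smul m c u)).2 (MemLp.const_smul hu.1 (c : ℂ)),
    (integrable_congr (ae_mul_norm_smul_sq V c u)).2 (hu.2.const_mul _)⟩

theorem normXSq_smul {N : ℕ} {𝕜 : Type*} [RCLike 𝕜] {m : ℝ} {V : EuclideanSpace ℝ (Fin N) → ℝ}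
    (c : ℝ) {u : L2 N 𝕜} (hu : u ∈ X 𝕜 m V) : normXSq m V (c • u) = c ^ 2 * normXSq m V u := by
  have eV : ∫ x, V x * ‖(c • u : L2 N 𝕜) x‖ ^ 2 = c ^ 2 * ∫ x, V x * ‖u x‖ ^ 2 := by
    rw [integral_congr_ae (ae_mul_norm_smul_sq V c u), integral_const_mul]
  have eS : ∫ ξ, ‖symbolMul m (c • u) ξ‖ ^ 2 = c ^ 2 * ∫ ξ, ‖symbolMul m u ξ‖ ^ 2 := by
    rw [← integral_const_mul]
    refine integral_congr_ae ((symbolMul_smul m c u).mono fun x hx => ?_)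
    simp only [hx]
    simp [mul_pow]
  simp only [norm_symbolMul_sq] at eS
  rw [normXSq, normXSq, (smul_mem_X c hu).1.integral_besselRoot, hu.1.integral_besselRoot, eV, eS]
  ring

theorem normX_smul {N : ℕ} {𝕜 : Type*} [RCLike 𝕜] {m : ℝ} {V : EuclideanSpace ℝ (Fin N) → ℝ}
    {c : ℝ} (hc : 0 ≤ c) {u : L2 N 𝕜} (hu : u ∈ X 𝕜 m V) :
    normX m V (c • u) = c * normX m V u := by
  rw [normX, normX, normXSq_smul c hu, Real.sqrt_mul (sq_nonneg c), Real.sqrt_sq hc]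

theorem nonlocalIntegrand_smul {N : ℕ} {𝕜 : Type*} [RCLike 𝕜] (p : ℝ)
    (A W : EuclideanSpace ℝ (Fin N) → ℝ) {c : ℝ} (hc : 0 < c) (u : L2 N 𝕜) :
    nonlocalIntegrand p A W (c • u) =ᵐ[volume]
      fun z => c ^ (2 * p) * nonlocalIntegrand p A W u z := by
  have h1 : ∀ᵐ z : EuclideanSpace ℝ (Fin N) × EuclideanSpace ℝ (Fin N), _ :=
    Measure.quasiMeasurePreserving_fst.ae (ae_norm_smul c u)
  have h2 : ∀ᵐ z : EuclideanSpace ℝ (Fin N) × EuclideanSpace ℝ (Fin N), _ :=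
    Measure.quasiMeasurePreserving_snd.ae (ae_norm_smul c u)
  filter_upwards [h1, h2] with z hz1 hz2
  rw [nonlocalIntegrand, nonlocalIntegrand, hz1, hz2, abs_of_pos hc,
    Real.mul_rpow hc.le (norm_nonneg _), Real.mul_rpow hc.le (norm_nonneg _), two_mul,
    Real.rpow_add hc]
  ring

theorem nonlocalTerm_smul {N : ℕ} {𝕜 : Type*} [RCLike 𝕜] (p : ℝ)
    (A W : EuclideanSpace ℝ (Fin N) → ℝ) {c : ℝ} (hc : 0 < c) (u : L2 N 𝕜) :
    nonlocalTerm p A W (c • u) = c ^ (2 * p) * nonlocalTerm p A W u := by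
  rw [nonlocalTerm, nonlocalTerm, integral_congr_ae (nonlocalIntegrand_smul p A W hc u),
    integral_const_mul]

theorem I_zero {N : ℕ} {𝕜 : Type*} [RCLike 𝕜] (m : ℝ) {p : ℝ} (hp : p ≠ 0)
    (V A W : EuclideanSpace ℝ (Fin N) → ℝ) : I m p V A W (0 : L2 N 𝕜) = 0 := by
  have hs : symbolMul m (0 : L2 N 𝕜) =ᵐ[volume] 0 := by
    have := symbolMul_smul m 0 (0 : L2 N 𝕜)
    rwa [zero_smul, Complex.ofReal_zero, zero_smul] at this
  have hB : MemBessel m (0 : L2 N 𝕜) := (memLp_congr_ae hs).2 MemLp.zero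
  have hX : (0 : L2 N 𝕜) ∈ X 𝕜 m V := ⟨hB, by
    simp⟩
  have hN := normXSq_smul 0 hX
  rw [zero_smul] at hN
  have hQ : nonlocalTerm p A W (0 : L2 N 𝕜) = 0 := by
    simp [nonlocalTerm, nonlocalIntegrand, Real.zero_rpow hp]
  rw [I, normX, hN, hQ]
  simp

/-! ### Test functions in `X` and positivity of the nonlocal term -/

theorem symbol_le {N : ℕ} (m : ℝ) (ξ : EuclideanSpace ℝ (Fin N)) :
    symbol m ξ ≤ 2 + m ^ 2 + (2 * Real.pi) ^ 2 * ‖ξ‖ ^ 2 := by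
  have h1 := symbol_sq m ξ
  have h2 : Real.sqrt ((2 * Real.pi * ‖ξ‖) ^ 2 + m ^ 2) ≤ 1 + ((2 * Real.pi * ‖ξ‖) ^ 2 + m ^ 2) := by
    rw [Real.sqrt_le_left (by positivity)]
    nlinarith [sq_nonneg (2 * Real.pi * ‖ξ‖), sq_nonneg m,
      sq_nonneg ((2 * Real.pi * ‖ξ‖) ^ 2 + m ^ 2)]
  nlinarith [sq_nonneg (symbol m ξ - 1)]

/-- Domination by a polynomial times `g`, which is again Schwartz; no smoothness of the symbol is
needed. -/
theorem memLp_symbol_mul_schwartz {N : ℕ} (m : ℝ)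
    (g : SchwartzMap (EuclideanSpace ℝ (Fin N)) ℂ) :
    MemLp (fun ξ => (symbol m ξ : ℂ) * g ξ) 2 volume := by
  set k : EuclideanSpace ℝ (Fin N) → ℝ := fun ξ => 2 + m ^ 2 + (2 * Real.pi) ^ 2 * ‖ξ‖ ^ 2 with hk
  have hkt : k.HasTemperateGrowth := by
    rw [hk]
    fun_prop
  have h := (SchwartzMap.smulLeftCLM ℂ k g).memLp 2 volume
  refine h.mono ?_ (Filter.Eventually.of_forall fun ξ => ?_)
  · exact ((Complex.continuous_ofReal.comp (continuous_symbol m)).mul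
      g.continuous).aestronglyMeasurable
  · rw [SchwartzMap.smulLeftCLM_apply_apply hkt, norm_mul, norm_smul]
    gcongr
    rw [Complex.norm_real]
    have h0 : 0 ≤ symbol m ξ := by unfold symbol; positivity
    rw [Real.norm_of_nonneg h0]
    exact (symbol_le m ξ).trans (le_abs_self _)

/-- Smooth compactly supported functions belong to `X`. -/
theorem exists_mem_X_of_contDiff {N : ℕ} (𝕜 : Type*) [RCLike 𝕜] (m : ℝ)
    {V : EuclideanSpace ℝ (Fin N) → ℝ} (hV : Continuous V) {φ : EuclideanSpace ℝ (Fin N) → ℝ}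
    (hφ : ContDiff ℝ ((⊤ : ℕ∞) : WithTop ℕ∞) φ) (hφc : HasCompactSupport φ) :
    ∃ u ∈ X 𝕜 m V, ∀ᵐ x, ‖u x‖ = |φ x| := by
  have hmem : MemLp (fun x => (φ x : 𝕜)) 2 volume :=
    (RCLike.continuous_ofReal.comp hφ.continuous).memLp_of_hasCompactSupport
      (hφc.comp_left (g := ((↑) : ℝ → 𝕜)) (by simp))
  set u : L2 N 𝕜 := hmem.toLp _ with hu
  have huc : u =ᵐ[volume] fun x => (φ x : 𝕜) := hmem.coeFn_toLp
  have hn : ∀ᵐ x, ‖u x‖ = |φ x| := by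
    filter_upwards [huc] with x hx
    rw [hx, RCLike.norm_ofReal]
  have h1 : HasCompactSupport (fun x => (φ x : ℂ)) :=
    hφc.comp_left (g := ((↑) : ℝ → ℂ)) (by simp)
  have h2 : ContDiff ℝ ((⊤ : ℕ∞) : WithTop ℕ∞) (fun x => (φ x : ℂ)) :=
    Complex.ofRealCLM.contDiff.comp hφ
  obtain ⟨Φ, hΦ⟩ : ∃ Φ : SchwartzMap (EuclideanSpace ℝ (Fin N)) ℂ, ∀ x, Φ x = (φ x : ℂ) :=
    ⟨h1.toSchwartzMap h2, fun x => rfl⟩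
  have hc : toComplex u = Φ.toLp 2 volume := by
    ext1
    filter_upwards [(RCLike.map 𝕜 ℂ).coeFn_compLp u, Φ.coeFn_toLp 2 volume, huc] with x e1 e2 e3
    rw [toComplex, e1, e2, e3, hΦ]
    simp [RCLike.map_apply]
  refine ⟨u, ⟨?_, ?_⟩, hn⟩
  · obtain ⟨Ψ, hΨ⟩ : ∃ Ψ : SchwartzMap (EuclideanSpace ℝ (Fin N)) ℂ,
        (𝓕 (toComplex u) : L2 N ℂ) = Ψ.toLp 2 volume :=
      ⟨𝓕 Φ, by rw [hc]; exact SchwartzMap.toLp_fourier_eq Φ⟩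
    refine (memLp_congr_ae ?_).2 (memLp_symbol_mul_schwartz m Ψ)
    filter_upwards [Ψ.coeFn_toLp 2 volume] with x hx
    rw [symbolMul, hΨ, hx]
  · have hi : Integrable (fun x => V x * φ x ^ 2) volume := by
      have hc2 : HasCompactSupport fun x => V x * φ x ^ 2 :=
        hφc.mono fun x hx h0 => hx (by simp [h0])
      exact (hV.mul (hφ.continuous.pow 2)).integrable_of_hasCompactSupport hc2
    refine (integrable_congr (hn.mono fun x hx => ?_)).2 hi
    simp only [hx, sq_abs]

/-- After the shear `(x, y) ↦ (x + y, y)` the condition involves only the first variable. -/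
theorem ae_eq_zero_of_ae_sub_eq_zero {N : ℕ} {W : EuclideanSpace ℝ (Fin N) → ℝ}
    (h : ∀ᵐ z : EuclideanSpace ℝ (Fin N) × EuclideanSpace ℝ (Fin N), W (z.1 - z.2) = 0) :
    ∀ᵐ x, W x = 0 := by
  have hmp := measurePreserving_add_prod
    (volume : Measure (EuclideanSpace ℝ (Fin N))) (volume : Measure (EuclideanSpace ℝ (Fin N)))
  have h1 := hmp.quasiMeasurePreserving.ae h
  simp only [add_sub_cancel_right] at h1
  filter_upwards [Measure.ae_ae_of_ae_prod h1] with x hx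
  simpa using hx

/-- Otherwise, for a bump positive on a ball, a nonnegative integrable function has integral 0, so
`W (x - y)` vanishes a.e. on the product of the ball with itself; such balls exhaust the space. -/
theorem exists_nonlocalTerm_pos {N : ℕ} {𝕜 : Type*} [RCLike 𝕜] {m p : ℝ}
    {V A W : EuclideanSpace ℝ (Fin N) → ℝ} (hV : Continuous V) (hA_one : ∀ᵐ x, 1 ≤ A x)
    (hint : ∀ u ∈ X 𝕜 m V, Integrable (nonlocalIntegrand p A W u) volume)
    (hW0 : ∀ᵐ x, 0 ≤ W x) (hW : ¬ ∀ᵐ x, W x = 0) :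
    ∃ u ∈ X 𝕜 m V, 0 < nonlocalTerm p A W u := by
  by_contra! hcon
  apply hW
  apply ae_eq_zero_of_ae_sub_eq_zero
  have hA1 : ∀ᵐ z : EuclideanSpace ℝ (Fin N) × EuclideanSpace ℝ (Fin N), _ :=
    Measure.quasiMeasurePreserving_fst.ae hA_one
  have hWs := (quasiMeasurePreserving_sub_prod N).ae hW0
  have key : ∀ n : ℕ, ∀ᵐ z : EuclideanSpace ℝ (Fin N) × EuclideanSpace ℝ (Fin N),
      ‖z.1‖ < n + 1 → ‖z.2‖ < n + 1 → W (z.1 - z.2) = 0 := by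
    intro n
    let b : ContDiffBump (0 : EuclideanSpace ℝ (Fin N)) :=
      ⟨(n + 1 : ℝ) / 2, n + 1, by positivity, by linarith [(Nat.cast_nonneg n : (0 : ℝ) ≤ n)]⟩
    obtain ⟨u, hu, hub⟩ := exists_mem_X_of_contDiff 𝕜 m hV b.contDiff b.hasCompactSupport
    have hnn : 0 ≤ᵐ[volume] nonlocalIntegrand p A W u := by
      filter_upwards [hA1, hWs] with z h1 h2
      have : 0 ≤ A z.1 := by linarith
      simp only [nonlocalIntegrand, Pi.zero_apply]
      positivity
    have hz : nonlocalTerm p A W u = 0 := le_antisymm (hcon u hu) (integral_nonneg_of_ae hnn)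
    rw [nonlocalTerm, integral_eq_zero_iff_of_nonneg_ae hnn (hint u hu)] at hz
    have hu1 : ∀ᵐ z : EuclideanSpace ℝ (Fin N) × EuclideanSpace ℝ (Fin N), _ :=
      Measure.quasiMeasurePreserving_fst.ae hub
    have hu2 : ∀ᵐ z : EuclideanSpace ℝ (Fin N) × EuclideanSpace ℝ (Fin N), _ :=
      Measure.quasiMeasurePreserving_snd.ae hub
    filter_upwards [hz, hA1, hu1, hu2] with z h1 h2 h3 h4 l1 l2
    have p1 : 0 < b z.1 := b.pos_of_mem_ball (by simpa [b] using l1)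
    have p2 : 0 < b z.2 := b.pos_of_mem_ball (by simpa [b] using l2)
    have q1 : 0 < ‖u z.1‖ := by rw [h3]; exact abs_pos.2 p1.ne'
    have q2 : 0 < ‖u z.2‖ := by rw [h4]; exact abs_pos.2 p2.ne'
    have r1 := (Real.rpow_pos_of_pos q1 p).ne'
    have r2 := (Real.rpow_pos_of_pos q2 p).ne'
    have r3 : A z.1 ≠ 0 := by linarith
    simpa [nonlocalIntegrand, r1, r2, r3] using h1
  filter_upwards [ae_all_iff.2 key] with z hz
  obtain ⟨n, hn⟩ := exists_nat_gt (max ‖z.1‖ ‖z.2‖)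
  exact hz n (by linarith [le_max_left ‖z.1‖ ‖z.2‖]) (by linarith [le_max_right ‖z.1‖ ‖z.2‖])

end Hartree

end

/-! ### Mountain pass geometry -/

theorem proposition5p1 {𝕜 : Type*} [RCLike 𝕜] (N : ℕ) (m p β r : ℝ)
    (V A W : EuclideanSpace ℝ (Fin N) → ℝ) (hm : 0 < m)
    (hN : 1 < N) (hβ : 1 < β) (hp : 2 ≤ p)
    (hp' : p < 2 * (N * β - 1) / (β * (N - 1)))
    (hr : max 1 ((1 - N * β) / (2 + β * N * (p - 2) - β * p)) < r)
    (hA_loc : ∀ K : Set (EuclideanSpace ℝ (Fin N)), IsCompact K →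
      MemLp A ⊤ (volume.restrict K))
    (hA_one : ∀ᵐ x, 1 ≤ A x)
    (hV : Continuous V) (hV_bdd : ∃ B : ℝ, 0 < B ∧ ∀ x, -B < V x)
    (hlam : 0 < Hartree.lambda1 𝕜 m V)
    (hAV : ∃ C₀ R₀ : ℝ, 0 < C₀ ∧ 0 < R₀ ∧ ∀ᵐ x : EuclideanSpace ℝ (Fin N), R₀ < ‖x‖ →
      A x ^ (2 * r / (2 * r - 1)) ≤ C₀ * (1 + max 0 (V x) ^ (1 / β)))
    (hW : ∃ W₁ W₂ : EuclideanSpace ℝ (Fin N) → ℝ,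
      MemLp W₁ (ENNReal.ofReal r) volume ∧ MemLp W₂ ⊤ volume ∧ ∀ᵐ x, W x = W₁ x + W₂ x) :
    -- the functional is well defined on `X`, and vanishes at the origin
    (∀ u ∈ Hartree.X 𝕜 m V, Integrable (Hartree.nonlocalIntegrand p A W u) volume) ∧
    Hartree.I m p V A W (0 : Hartree.L2 N 𝕜) = 0 ∧
    -- mountain pass geometry
    (∃ ρ : ℝ, 0 < ρ ∧
      (∃ α : ℝ, 0 < α ∧
        ∀ u ∈ Hartree.X 𝕜 m V, Hartree.normX m V u = ρ → α ≤ Hartree.I m p V A W u) ∧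
      ((∃ u ∈ Hartree.X 𝕜 m V, 0 < Hartree.nonlocalTerm p A W u) →
        ∃ e ∈ Hartree.X 𝕜 m V, ρ < Hartree.normX m V e ∧ Hartree.I m p V A W e < 0)) ∧
    -- the nonlocal term takes positive values if `W` is nonnegative and nontrivial
    ((∀ᵐ x, 0 ≤ W x) → ¬ (∀ᵐ x, W x = 0) →
      ∃ u ∈ Hartree.X 𝕜 m V, 0 < Hartree.nonlocalTerm p A W u) := by
  have hp0 : 0 < p := by linarith
  obtain ⟨B, hB, hVB⟩ := hV_bdd
  obtain ⟨C, hC⟩ := Hartree.exists_nonlocalTerm_le (𝕜 := 𝕜) hN hβ hp hp' hr hA_loc hA_one hV hB hVB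
    hlam hAV hW
  have hsq : ∀ u ∈ Hartree.X 𝕜 m V, Hartree.normX m V u ^ 2 = Hartree.normXSq m V u :=
    fun u hu => Real.sq_sqrt (Hartree.normXSq_nonneg hlam hu)
  have hnormalize : ∀ u ∈ Hartree.X 𝕜 m V, 0 < Hartree.normX m V u →
      Hartree.normXSq m V ((Hartree.normX m V u)⁻¹ • u) ≤ 1 := by
    intro u hu hpos
    rw [Hartree.normXSq_smul _ hu, ← hsq u hu, ← mul_pow, inv_mul_cancel₀ hpos.ne', one_pow]
  have hint : ∀ u ∈ Hartree.X 𝕜 m V, Integrable (Hartree.nonlocalIntegrand p A W u) volume := by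
    intro u hu
    rcases (Real.sqrt_nonneg (Hartree.normXSq m V u)).eq_or_lt with h0 | hpos
    · refine (hC u hu ?_).1
      rw [← hsq u hu, Hartree.normX, ← h0]
      norm_num
    · have h1 := (hC _ (Hartree.smul_mem_X _ hu) (hnormalize u hu hpos)).1
      have hc : 0 < (Hartree.normX m V u)⁻¹ := inv_pos.2 hpos
      rw [integrable_congr (Hartree.nonlocalIntegrand_smul p A W hc u)] at h1
      exact (integrable_const_mul_iff (Real.rpow_pos_of_pos hc _).ne'.isUnit _).1 h1
  refine ⟨hint, Hartree.I_zero m hp0.ne' V A W, ?_,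
    fun h1 h2 => Hartree.exists_nonlocalTerm_pos hV hA_one hint h1 h2⟩
  -- With `ρ = D⁻¹`, scaling gives `D ^ (2 * p) * Q ≤ C ≤ D`, whence `Q ≤ ρ ^ 3 ≤ ρ ^ 2`. As `1 / (2
  -- * p) ≤ 1 / 4`, at least `ρ ^ 2 / 2 - ρ ^ 2 / 4` remains.
  set D : ℝ := max C 1 with hD
  have hD1 : 1 ≤ D := le_max_right _ _
  have hD0 : 0 < D := by linarith
  have hρ1 : D⁻¹ ≤ 1 := inv_le_one_of_one_le₀ hD1
  refine ⟨D⁻¹, by positivity, ⟨D⁻¹ ^ 2 / 4, by positivity, fun u hu hρ => ?_⟩, ?_⟩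
  · have hpos : 0 < Hartree.normX m V u := by rw [hρ]; positivity
    have h1 := (hC _ (Hartree.smul_mem_X _ hu) (hnormalize u hu hpos)).2
    rw [Hartree.nonlocalTerm_smul p A W (inv_pos.2 hpos), hρ, inv_inv] at h1
    have h2 : D ^ 4 ≤ D ^ (2 * p) := by
      rw [← Real.rpow_natCast]
      exact Real.rpow_le_rpow_of_exponent_le hD1 (by push_cast; linarith)
    have h3 : Hartree.nonlocalTerm p A W u ≤ D⁻¹ ^ 3 := by
      -- The nonlocal term may be negative; replacing `D ^ (2 * p)` by `D ^ 4` in front of it needs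
      -- a positive sign.
      by_contra! hlt
      have h0 : 0 < Hartree.nonlocalTerm p A W u := lt_trans (by positivity) hlt
      have h4 : D ^ 4 * D⁻¹ ^ 3 < D := by
        calc D ^ 4 * D⁻¹ ^ 3 < D ^ 4 * Hartree.nonlocalTerm p A W u := by gcongr
          _ ≤ D ^ (2 * p) * Hartree.nonlocalTerm p A W u := by gcongr
          _ ≤ C := h1
          _ ≤ D := le_max_left _ _
      have h5 : D ^ 4 * D⁻¹ ^ 3 = D := by field_simp
      linarith
    have h4 : D⁻¹ ^ 3 ≤ D⁻¹ ^ 2 := pow_le_pow_of_le_one (by positivity) hρ1 (by norm_num)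
    have h5 : 1 / (2 * p) ≤ 1 / 4 := by
      apply one_div_le_one_div_of_le <;> linarith
    have h6 : 1 / (2 * p) * Hartree.nonlocalTerm p A W u ≤ 1 / 4 * D⁻¹ ^ 2 :=
      calc _ ≤ 1 / (2 * p) * D⁻¹ ^ 2 := by gcongr; exact h3.trans h4
        _ ≤ _ := by gcongr
    rw [Hartree.I, hρ]
    linarith
  · rintro ⟨u, hu, hQ⟩
    set Q := Hartree.nonlocalTerm p A W u with hQdef
    have hune : u ≠ 0 := by
      rintro rfl
      rw [hQdef] at hQ
      simp [Hartree.nonlocalTerm, Hartree.nonlocalIntegrand, Real.zero_rpow hp0.ne'] at hQ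
    have hpos : 0 < Hartree.normX m V u := by
      have hn : 0 < ‖u‖ := norm_pos_iff.2 hune
      exact Real.sqrt_pos.2 (lt_of_lt_of_le (by positivity)
        (Hartree.lambda1_mul_le_normXSq hlam hu))
    set a := Hartree.normX m V u with ha
    -- The summands ensure, in turn, `t ^ 4 ≤ t ^ (2 * p)`, `t * a > ρ` and `t ^ 2 * Q > p * a ^ 2`.
    set t : ℝ := 1 + D⁻¹ / a + p * a ^ 2 / Q with ht
    have hx : 0 < D⁻¹ / a := by positivity
    have hy : 0 < p * a ^ 2 / Q := by positivity
    have ht1 : 1 ≤ t := by linarith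
    have ht0 : 0 < t := by linarith
    refine ⟨t • u, Hartree.smul_mem_X t hu, ?_, ?_⟩
    · rw [Hartree.normX_smul ht0.le hu, ← ha, ← div_lt_iff₀ hpos]
      linarith
    · rw [Hartree.I, Hartree.normX_smul ht0.le hu, Hartree.nonlocalTerm_smul p A W ht0 u, ← ha,
        ← hQdef]
      have h2 : t ^ 4 ≤ t ^ (2 * p) := by
        rw [← Real.rpow_natCast]
        exact Real.rpow_le_rpow_of_exponent_le ht1 (by push_cast; linarith)
      have h3 : p * a ^ 2 < t ^ 2 * Q := by
        rw [← div_lt_iff₀ hQ]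
        nlinarith
      have h4 : t ^ 2 * (p * a ^ 2) < t ^ (2 * p) * Q :=
        calc t ^ 2 * (p * a ^ 2) < t ^ 2 * (t ^ 2 * Q) := by gcongr
          _ = t ^ 4 * Q := by ring
          _ ≤ _ := by gcongr
      have h5 : 1 / 2 * (t * a) ^ 2 = 1 / (2 * p) * (t ^ 2 * (p * a ^ 2)) := by
        field_simp
      rw [h5, sub_neg]
      gcongr
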